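/- **Theorem (Aggregation).** Consider a discounted Markov decision process with finite state space $S$, finite nonempty action sets $\mathcal A(i)$ ($i\in S$), transition probabilities $P_{ij}(u)$, costs $c(i,u)\ge 0$ and discount factor $\alpha\in(0,1)$. A policy $\mu$ chooses an action $\mu(i)\in\mathcal A(i)$ for every $i \in S$. It induces a Markov chain $(X^\mu_m)_{m\ge0}$ on $S$ with transition probabilities $P_{ij}(\mu(i))$; let $J^\mu(i)=\mathbb E\big[\sum_{m\ge0}\alpha^m c(X^\mu_m,\mu(X^\mu_m))\,\big|\,X_0^\mu=i\big]$, $J^*=\min_\mu J^\mu$ and $(T_\mu J)(i)=c(i,\mu(i))+\alpha\sum_jP_{ij}(\mu(i))J(j)$. Let $G$ be the directed graph on $S$ with an edge $(i,j)$ whenever $P_{ij}(u)>0$ for some $u\in\mathcal A(i)$. A state $i$ is recurrent if $i$ can be reached in $G$ from every state that can be reached from $i$, and transient otherwise; it is absorbing if $P_{ii}(u)=1$ for all $u\in\mathcal A(i)$. Let $p$ be a probability distribution on $S$, and let $S$ be partitioned into clusters $\mathcal C_1,\dots,\mathcal C_k$. Assume: 1. for all $i,j\in S$ and $u,v\in\mathcal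 A(i)$: $P_{ij}(u)>0$ if and only if $P_{ij}(v)>0$; 2. the subgraph of $G$ induced by the transient states has no directed cycle (in particular no self-loop), and every state that is not transient is absorbing; 3. $J^*(i)=J^*(j)$ whenever $i,j$ lie in the same cluster; 4. all states in the same cluster have the same maximum distance to an absorbing state, that is, the same maximal length of a directed path (without repeated vertices) in $G$ to an absorbing state; 5. for every policy $\mu$ and every cluster $\mathcal C_c$, the chain $X^\mu$ with initial distribution $p$ visits $\mathcal C_c$ with positive probability. Let $\beta:\mathbb N\to[0,\infty)$ satisfy $\sum_t\beta(t)=\infty$ and $\sum_t\beta(t)^2<\infty$. Starting from a deterministic $\theta_0\in\mathbb R^k$, the algorithm does the following in each iteration $t=0,1,2,\dots$: it sets $J_t(i)=\theta_t(c)$ for $i\in\mathcal C_c$; it takes a greedy policy $\mu_t\in\arg\min_\mu T_\mu J_t$, where ties may be broken in any way that depends only on the information available before the trajectory of iteration $t$ is simulated; it simulates a trajectory $X^{\mu_t}$ which, conditionally on that information, is a Markov chain induced by $\mu_t$ with initial distribution $p$; and for every cluster $\mathcal C_c$ visited by the trajectory, first at time $N_t(c)$, it sets $$\theta_{t+1}(c)=(1-\gamma_t(c))\,\theta_t(c)+\gamma_t(c)\sum_{m\ge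 N_t(c)}\alpha^{m-N_t(c)}c\big(X^{\mu_t}_m,\mu_t(X^{\mu_t}_m)\big),$$ while $\theta_{t+1}(c)=\theta_t(c)$ for the clusters that are not visited. The step sizes are either $\gamma_t(c)=\beta(t)$ for all $t,c$, or $\gamma_t(c)=\beta(n_t(c))$ for all $t,c$, where $n_t(c)$ is the number of iterations $\tau<t$ whose trajectory visited $\mathcal C_c$. Then, almost surely, $J_t(i)\to J^*(i)$ as $t\to\infty$ for every $i\in S$; equivalently, almost surely $\theta_t(c)$ converges to the common value of $J^*$ on $\mathcal C_c$ for every $c$. -/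

import Mathlib

open MeasureTheory ProbabilityTheory Filter Topology

noncomputable section

/-- A discounted Markov decision process on the finite state space `S`, with action space `A i`
at state `i`, transition probabilities `P i u j`, nonnegative costs and discount factor in
`(0, 1)`. -/
structure DiscountedMDP (S : Type*) (A : S → Type*) where
  P : (i : S) → A i → PMF S
  cost : (i : S) → A i → ℝ
  cost_nonneg : ∀ i u, 0 ≤ cost i u
  discount : ℝ
  discount_pos : 0 < discount
  discount_lt_one : discount < 1

namespace DiscountedMDP

variable {S : Type*} {A : S → Type*} (M : DiscountedMDP S A)

/-! ### The reachability graph -/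

/-- The edges of the reachability graph. -/
def Edge (i j : S) : Prop := ∃ u : A i, 0 < M.P i u j

/-- The successors of a state do not depend on the action. -/
def CommonTransitions : Prop :=
  ∀ (i j : S) (u v : A i), 0 < M.P i u j ↔ 0 < M.P i v j

/-- `j` can be reached from `i` in zero or more steps of the reachability graph. -/
def Reaches (i j : S) : Prop := Relation.ReflTransGen M.Edge i j

/-- `i` lies in a closed irreducible class: every state reachable from `i` leads back to `i`. -/
def IsRecurrent (i : S) : Prop := ∀ j, M.Reaches i j → M.Reaches j i

def IsTransient (i : S) : Prop := ¬ M.IsRecurrent i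

def IsAbsorbing (i : S) : Prop := ∀ u : A i, M.P i u i = 1

/-- The subgraph induced by the transient states has no directed cycle (self-loops included). -/
def TransientAcyclic : Prop :=
  ∀ i, ¬ Relation.TransGen (fun a b => M.IsTransient a ∧ M.IsTransient b ∧ M.Edge a b) i i

/-- There is a directed path (no repeated vertex) of length `l` from `i` to an absorbing state. -/
def PathToAbsorbing (i : S) (l : ℕ) : Prop :=
  ∃ x : Fin (l + 1) → S, Function.Injective x ∧ x 0 = i ∧ M.IsAbsorbing (x (Fin.last l)) ∧
    ∀ m : Fin l, M.Edge (x m.castSucc) (x m.succ)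

/-- The maximum distance from `i` to an absorbing state: the greatest length of a path from `i`
to an absorbing state (lengths are bounded since paths do not repeat vertices). -/
def maxDist (i : S) : ℕ := sSup {l | M.PathToAbsorbing i l}

/-! ### Trajectories and value functions -/

/-- The Bellman operator `T_π`. -/
def bellman [Fintype S] (π : ∀ i, A i) (J : S → ℝ) (i : S) : ℝ :=
  M.cost i (π i) + M.discount * ∑ j, (M.P i (π i) j).toReal * J j

section Trajectories

variable [Fintype S] [MeasurableSpace S] [MeasurableSingletonClass S]

/-- The one-step transition kernel of the Markov chain induced by the policy `π`. -/
def stepKernel (π : ∀ i, A i) : Kernel S S :=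
  Kernel.ofFunOfCountable fun i => (M.P i (π i)).toMeasure

instance (π : ∀ i, A i) : IsMarkovKernel (M.stepKernel π) :=
  ⟨fun i => by
    change IsProbabilityMeasure (M.P i (π i)).toMeasure
    infer_instance⟩

/-- The law of the next state given the states up to time `n`. -/
def historyKernel (π : ∀ i, A i) (n : ℕ) : Kernel (Finset.Iic n → S) S :=
  (M.stepKernel π).comap (fun h => h ⟨n, Finset.mem_Iic.2 le_rfl⟩) (measurable_pi_apply _)

instance (π : ∀ i, A i) (n : ℕ) : IsMarkovKernel (M.historyKernel π n) := by
  unfold historyKernel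
  infer_instance

/-- The law of the trajectory of the Markov chain induced by `π` and started at `i`. -/
def trajLaw (π : ∀ i, A i) (i : S) : Measure (ℕ → S) :=
  Kernel.traj (X := fun _ => S) (M.historyKernel π) 0 fun _ => i

/-- The law of the trajectory of the Markov chain induced by `π` with initial distribution
`p`. -/
def chainLaw (p : PMF S) (π : ∀ i, A i) : Measure (ℕ → S) :=
  ∑ i, p i • M.trajLaw π i

end Trajectories

/-- The discounted cost of the trajectory `x` from time `N` on, discounted to time `N`. -/
def costFrom (π : ∀ i, A i) (N : ℕ) (x : ℕ → S) : ℝ :=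
  ∑' m : ℕ, M.discount ^ m * M.cost (x (N + m)) (π (x (N + m)))

section Values

variable [Fintype S] [MeasurableSpace S] [MeasurableSingletonClass S]

/-- The value function `J^π`. -/
def value (π : ∀ i, A i) (i : S) : ℝ := ∫ x, M.costFrom π 0 x ∂(M.trajLaw π i)

/-- The optimal value function `J^*`, the minimum of `J^π` over the finitely many policies. -/
def optValue (i : S) : ℝ := ⨅ π : ∀ i, A i, M.value π i

end Values

/-! ### Clusters and the aggregated algorithm -/

/-- The trajectory `x` visits the cluster `c`; `cl i` is the cluster that contains `i`. -/
def Visits {k : ℕ} (cl : S → Fin k) (x : ℕ → S) (c : Fin k) : Prop := ∃ m, cl (x m) = c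

/-- The first time at which `x` visits the cluster `c` (used only if `x` visits `c`). -/
def firstVisit {k : ℕ} (cl : S → Fin k) (x : ℕ → S) (c : Fin k) : ℕ := sInf {m | cl (x m) = c}

/-- The tail cost of the trajectory from its first visit to the cluster `c`. -/
def tailCost {k : ℕ} (cl : S → Fin k) (π : ∀ i, A i) (x : ℕ → S) (c : Fin k) : ℝ :=
  M.costFrom π (firstVisit cl x c) x

/-- The number of iterations before iteration `t` whose trajectory visits the cluster `c`, for
the sequence `x` of trajectories. -/
def visitCount {k : ℕ} (cl : S → Fin k) (x : ℕ → ℕ → S) (t : ℕ) (c : Fin k) : ℕ :=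
  {τ | τ < t ∧ Visits cl (x τ) c}.ncard

/-- A run of optimistic policy iteration with state aggregation on the probability space
`(Ω, Pr)`: `ℱ t` is the information available before the trajectory of iteration `t` is simulated,
`μ t` the policy used and `X t` the trajectory simulated in iteration `t`, `γ t c` the step sizes,
`θ t` the vector of cluster parameters, and `θ₀` its deterministic initial value. Ties in the
choice of the greedy policy may be broken in any way that depends on `ℱ t` only. -/
structure IsAggregatedOPI [Fintype S] [MeasurableSpace S] [MeasurableSingletonClass S]
    {k : ℕ} (cl : S → Fin k) (p : PMF S) (θ₀ : Fin k → ℝ)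
    {Ω : Type*} {mΩ : MeasurableSpace Ω} (Pr : Measure Ω) (ℱ : Filtration ℕ mΩ)
    (γ : ℕ → Ω → Fin k → ℝ) (μ : ℕ → Ω → ∀ i, A i) (X : ℕ → Ω → ℕ → S)
    (θ : ℕ → Ω → Fin k → ℝ) : Prop where
  init : ∀ ω, θ 0 ω = θ₀
  /-- `μ t` minimizes `T_π J_t` over all policies `π`, where `J_t i = θ_t (cl i)`. -/
  greedy : ∀ t ω (π : ∀ i, A i),
    M.bellman (μ t ω) (fun i => θ t ω (cl i)) ≤ M.bellman π (fun i => θ t ω (cl i))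
  policy_measurable : ∀ t (π : ∀ i, A i), MeasurableSet[ℱ t] {ω | μ t ω = π}
  traj_measurable : ∀ t, Measurable[ℱ (t + 1)] (X t)
  /-- Given the past, the trajectory is that of the Markov chain induced by `μ t`, with initial
  state drawn from `p`. -/
  traj_law : ∀ t (B : Set (ℕ → S)), MeasurableSet B →
    Pr⟦X t ⁻¹' B | ℱ t⟧ =ᵐ[Pr] fun ω => (M.chainLaw p (μ t ω)).real B
  update_visited : ∀ t ω c, Visits cl (X t ω) c →
    θ (t + 1) ω c = (1 - γ t ω c) * θ t ω c + γ t ω c * M.tailCost cl (μ t ω) (X t ω) c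
  update_not_visited : ∀ t ω c, ¬ Visits cl (X t ω) c → θ (t + 1) ω c = θ t ω c

end DiscountedMDP

end

/-!
The cost simulated from the first visit to a cluster on, minus the value of the policy at the state
in which the cluster is entered, is a discounted sum of temporal-difference errors. These are
centred given the past, so the noise of the updates is a martingale difference sequence. Its
quadratic variation is at most a multiple of `∑ β²`, hence the noise summed over the iterations
converges almost surely. Every policy visits a cluster with probability bounded away from zero, so
the conditional Borel–Cantelli lemma gives every cluster an infinite total step size.

On these events induct on the maximum distance to an absorbing state. Where the parameters of all
smaller distances have converged, greedy policies are eventually optimal, because there are only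
finitely many policies and edges strictly decrease the distance. From then on the parameter of the
cluster is averaged towards the optimal value with summable noise, which forces convergence.
-/

/-! ### Averaging recursions -/

theorem eventually_le_of_contraction {u a : ℕ → ℝ} (ha : ∀ᶠ t in atTop, 0 ≤ a t ∧ a t ≤ 1)
    (hsum : Tendsto (fun n => ∑ t ∈ Finset.range n, a t) atTop atTop)
    (hu : ∀ᶠ t in atTop, u (t + 1) ≤ (1 - a t) * u t) {ε : ℝ} (hε : 0 < ε) :
    ∀ᶠ t in atTop, u t ≤ ε := by
  obtain ⟨T, hT⟩ := (ha.and hu).exists_forall_of_atTop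
  set C := max (u T) 0 * Real.exp (∑ j ∈ Finset.range T, a j) with hC
  have : 0 ≤ C := by positivity
  have hle : ∀ t, T ≤ t → u t ≤ C * Real.exp (-∑ j ∈ Finset.range t, a j) := by
    intro t ht
    induction t, ht using Nat.le_induction with
    | base => simp [hC, mul_assoc, ← Real.exp_add]
    | succ t ht ih =>
      obtain ⟨⟨-, h1⟩, hstep⟩ := hT t ht
      have hexp : 1 - a t ≤ Real.exp (-a t) := Real.one_sub_le_exp_neg _
      calc u (t + 1) ≤ (1 - a t) * u t := hstep
        _ ≤ (1 - a t) * (C * Real.exp (-∑ j ∈ Finset.range t, a j)) := by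
          gcongr
        _ ≤ Real.exp (-a t) * (C * Real.exp (-∑ j ∈ Finset.range t, a j)) := by gcongr
        _ = C * Real.exp (-∑ j ∈ Finset.range (t + 1), a j) := by
          rw [Finset.sum_range_succ, neg_add, Real.exp_add]
          ring
  have hlim : Tendsto (fun t => C * Real.exp (-∑ j ∈ Finset.range t, a j)) atTop (𝓝 0) := by
    simpa using (Real.tendsto_exp_neg_atTop_nhds_zero.comp hsum).const_mul C
  filter_upwards [hlim.eventually_le_const hε, eventually_ge_atTop T] with t ht hTt
  exact (hle t hTt).trans ht

section Averaging

variable {E : Type*} [NormedAddCommGroup E] [NormedSpace ℝ E] {a : ℕ → ℝ}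

theorem tendsto_zero_of_averaging {x r : ℕ → E} (ha : ∀ᶠ t in atTop, 0 ≤ a t ∧ a t ≤ 1)
    (hsum : Tendsto (fun n => ∑ t ∈ Finset.range n, a t) atTop atTop)
    (hr : Tendsto r atTop (𝓝 0))
    (hx : ∀ᶠ t in atTop, x (t + 1) = (1 - a t) • x t + a t • r t) :
    Tendsto x atTop (𝓝 0) := by
  rw [NormedAddGroup.tendsto_nhds_zero] at hr ⊢
  intro ε hε
  have hstep : ∀ᶠ t in atTop, ‖x (t + 1)‖ - ε / 3 ≤ (1 - a t) * (‖x t‖ - ε / 3) := by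
    filter_upwards [ha, hx, hr (ε / 3) (by positivity)] with t ⟨h0, h1⟩ hxt hrt
    have hnorm : ‖x (t + 1)‖ ≤ (1 - a t) * ‖x t‖ + a t * ‖r t‖ := by
      rw [hxt]
      refine (norm_add_le _ _).trans_eq ?_
      rw [norm_smul_of_nonneg (sub_nonneg.2 h1), norm_smul_of_nonneg h0]
    linarith [mul_le_mul_of_nonneg_left hrt.le h0]
  filter_upwards [eventually_le_of_contraction (u := fun t => ‖x t‖ - ε / 3) ha hsum hstep
    (by positivity : 0 < ε / 3)] with t ht
  linarith

theorem tendsto_zero_of_averaging_add_noise {x s : ℕ → E} {l : E}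
    (ha : ∀ᶠ t in atTop, 0 ≤ a t ∧ a t ≤ 1)
    (hsum : Tendsto (fun n => ∑ t ∈ Finset.range n, a t) atTop atTop)
    (hs : Tendsto s atTop (𝓝 l))
    (hx : ∀ᶠ t in atTop, x (t + 1) = (1 - a t) • x t + (s (t + 1) - s t)) :
    Tendsto x atTop (𝓝 0) := by
  have hr : Tendsto (fun t => s t - l) atTop (𝓝 0) := tendsto_sub_nhds_zero_iff.2 hs
  -- Removing the remainder of the noise series turns the noise into an averaged null sequence.
  have hy : Tendsto (fun t => x t - (s t - l)) atTop (𝓝 0) := by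
    refine tendsto_zero_of_averaging ha hsum (r := fun t => -(s t - l)) (by simpa using hr.neg) ?_
    filter_upwards [hx] with t ht
    rw [ht]
    module
  simpa using hy.add hr

end Averaging

theorem eventually_forall_le_of_tendsto {ι α : Type*} [Finite ι] {l : Filter α}
    {F : ι → α → ℝ} {f : ι → ℝ} (hF : ∀ i, Tendsto (F i) l (𝓝 (f i))) {i : α → ι}
    (hi : ∀ a j, F (i a) a ≤ F j a) : ∀ᶠ a in l, ∀ j, f (i a) ≤ f j := by
  have hlt : ∀ i j, ∀ᶠ a in l, f j < f i → F j a < F i a := fun i j => by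
    by_cases hij : f j < f i
    · filter_upwards [(hF j).eventually_lt (hF i) hij] with a ha _ using ha
    · exact Eventually.of_forall fun a h => absurd h hij
  filter_upwards [eventually_all.2 fun i => eventually_all.2 (hlt i)] with a ha j
  exact not_lt.1 fun h => (ha (i a) j h).not_ge (hi a j)

/-! ### Monotone contractions -/

section MonotoneContraction

variable {X : Type*} [MetricSpace X] [CompleteSpace X] [Preorder X] [OrderClosedTopology X]
  {K : NNReal} {f : X → X} {x y : X}

theorem le_fixedPoint_of_le_map (hf : ContractingWith K f) (hmono : Monotone f)
    (hy : f y = y) (hx : x ≤ f x) : x ≤ y := by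
  have : Nonempty X := ⟨x⟩
  have hlim := hf.tendsto_iterate_fixedPoint x
  rw [← hf.fixedPoint_unique hy] at hlim
  exact (hmono.monotone_iterate_of_le_map hx).ge_of_tendsto hlim 0

theorem fixedPoint_le_of_map_le (hf : ContractingWith K f) (hmono : Monotone f)
    (hy : f y = y) (hx : f x ≤ x) : y ≤ x := by
  have : Nonempty X := ⟨x⟩
  have hlim := hf.tendsto_iterate_fixedPoint x
  rw [← hf.fixedPoint_unique hy] at hlim
  exact (hmono.antitone_iterate_of_map_le hx).le_of_tendsto hlim 0

end MonotoneContraction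

/-! ### Series of martingale differences -/

section MartingaleDifferences

variable {Ω : Type*} {mΩ : MeasurableSpace Ω} {P : Measure Ω}

theorem condExp_mul_eq_zero {m : MeasurableSpace Ω} {f g : Ω → ℝ} (hf : StronglyMeasurable[m] f)
    (hg : Integrable g P) (hfg : Integrable (f * g) P) (h : P[g | m] =ᵐ[P] 0) :
    P[f * g | m] =ᵐ[P] 0 := by
  filter_upwards [condExp_mul_of_stronglyMeasurable_left hf hfg hg, h] with ω hmul hω
  simp [hmul, hω]

theorem integral_mul_eq_zero_of_condExp_eq_zero {m : MeasurableSpace Ω} (hm : m ≤ mΩ)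
    [SigmaFinite (P.trim hm)] {f g : Ω → ℝ} (hf : StronglyMeasurable[m] f)
    (hg : Integrable g P) (hfg : Integrable (f * g) P) (h : P[g | m] =ᵐ[P] 0) :
    ∫ ω, f ω * g ω ∂P = 0 :=
  calc ∫ ω, f ω * g ω ∂P = ∫ ω, P[f * g | m] ω ∂P := (integral_condExp hm).symm
    _ = 0 := by simp [integral_congr_ae (condExp_mul_eq_zero hf hg hfg h)]

variable [IsFiniteMeasure P] {ℱ : Filtration ℕ mΩ} {ξ : ℕ → Ω → ℝ}

theorem martingale_sum_range (hm : ∀ t, StronglyMeasurable[ℱ (t + 1)] (ξ t))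
    (hint : ∀ t, Integrable (ξ t) P) (hcond : ∀ t, P[ξ t | ℱ t] =ᵐ[P] 0) :
    Martingale (fun n => ∑ t ∈ Finset.range n, ξ t) ℱ P := by
  refine martingale_of_condExp_sub_eq_zero_nat (fun n => ?_)
    (fun n => integrable_finsetSum' _ fun t _ => hint t) fun n => ?_
  · exact Finset.stronglyMeasurable_sum (m := ℱ n) _ fun t ht =>
      (hm t).mono (ℱ.mono (Finset.mem_range.1 ht))
  · simpa [Finset.sum_range_succ] using hcond n

theorem integral_sum_range_sq (hm : ∀ t, StronglyMeasurable[ℱ (t + 1)] (ξ t))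
    (hL2 : ∀ t, MemLp (ξ t) 2 P) (hcond : ∀ t, P[ξ t | ℱ t] =ᵐ[P] 0) (n : ℕ) :
    ∫ ω, (∑ t ∈ Finset.range n, ξ t) ω ^ 2 ∂P = ∑ t ∈ Finset.range n, ∫ ω, ξ t ω ^ 2 ∂P := by
  have hmart := martingale_sum_range hm (fun t => (hL2 t).integrable one_le_two) hcond
  induction n with
  | zero => simp
  | succ n ih =>
    set Y := ∑ t ∈ Finset.range n, ξ t with hY
    have hY2 : MemLp Y 2 P := memLp_finsetSum' _ fun t _ => hL2 t
    have hYξ : Integrable (Y * ξ n) P := hY2.integrable_mul (hL2 n)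
    have hcross : ∫ ω, Y ω * ξ n ω ∂P = 0 :=
      integral_mul_eq_zero_of_condExp_eq_zero (ℱ.le n) (hmart.stronglyMeasurable n)
        ((hL2 n).integrable one_le_two) hYξ (hcond n)
    calc ∫ ω, (∑ t ∈ Finset.range (n + 1), ξ t) ω ^ 2 ∂P
        = ∫ ω, (Y ω ^ 2 + 2 * (Y ω * ξ n ω)) + ξ n ω ^ 2 ∂P := by
          simp only [Finset.sum_range_succ, Pi.add_apply, add_sq, mul_assoc, ← hY]
      _ = ∑ t ∈ Finset.range (n + 1), ∫ ω, ξ t ω ^ 2 ∂P := by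
          have h2 : Integrable (fun ω => 2 * (Y ω * ξ n ω)) P := hYξ.const_mul 2
          have h3 : Integrable (fun ω => Y ω ^ 2 + 2 * (Y ω * ξ n ω)) P :=
            hY2.integrable_sq.add h2
          rw [integral_add h3 (hL2 n).integrable_sq, integral_add hY2.integrable_sq h2,
            integral_const_mul, hcross, ih, Finset.sum_range_succ]
          ring

theorem ae_exists_tendsto_sum_range_of_condExp_eq_zero
    (hm : ∀ t, StronglyMeasurable[ℱ (t + 1)] (ξ t)) (hL2 : ∀ t, MemLp (ξ t) 2 P)
    (hcond : ∀ t, P[ξ t | ℱ t] =ᵐ[P] 0) {K : ℝ}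
    (hK : ∀ n, ∑ t ∈ Finset.range n, ∫ ω, ξ t ω ^ 2 ∂P ≤ K) :
    ∀ᵐ ω ∂P, ∃ l, Tendsto (fun n => ∑ t ∈ Finset.range n, ξ t ω) atTop (𝓝 l) := by
  have hmart := martingale_sum_range hm (fun t => (hL2 t).integrable one_le_two) hcond
  have hsq : ∀ n, MemLp (∑ t ∈ Finset.range n, ξ t) 2 P := fun n =>
    memLp_finsetSum' _ fun t _ => hL2 t
  have hL1 : ∀ n, ∫ ω, ‖(∑ t ∈ Finset.range n, ξ t) ω‖ ∂P ≤ P.real Set.univ + K := fun n =>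
    calc ∫ ω, ‖(∑ t ∈ Finset.range n, ξ t) ω‖ ∂P
        ≤ ∫ ω, (1 + (∑ t ∈ Finset.range n, ξ t) ω ^ 2) ∂P :=
          integral_mono (hmart.integrable n).norm
            ((integrable_const _).add (hsq n).integrable_sq) fun ω => by
              rw [Real.norm_eq_abs, ← sq_abs]
              nlinarith [sq_nonneg (|(∑ t ∈ Finset.range n, ξ t) ω| - 1)]
      _ = P.real Set.univ + ∑ t ∈ Finset.range n, ∫ ω, ξ t ω ^ 2 ∂P := by
          rw [integral_add (integrable_const _) (hsq n).integrable_sq,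
            integral_sum_range_sq hm hL2 hcond, integral_const, smul_eq_mul, mul_one]
      _ ≤ P.real Set.univ + K := by gcongr; exact hK n
  have hlim := hmart.submartingale.exists_ae_tendsto_of_bdd
    (R := (P.real Set.univ + K).toNNReal) fun n => by
      rw [eLpNorm_one_eq_lintegral_enorm,
        ← ofReal_integral_norm_eq_lintegral_enorm (hmart.integrable n)]
      exact ENNReal.ofReal_le_ofReal (hL1 n)
  simpa only [Finset.sum_apply] using hlim

theorem ae_exists_tendsto_sum_range_of_sum_sq_le
    (hm : ∀ t, StronglyMeasurable[ℱ (t + 1)] (ξ t)) (hcond : ∀ t, P[ξ t | ℱ t] =ᵐ[P] 0) {K : ℝ}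
    (hK : ∀ n ω, ∑ t ∈ Finset.range n, ξ t ω ^ 2 ≤ K) :
    ∀ᵐ ω ∂P, ∃ l, Tendsto (fun n => ∑ t ∈ Finset.range n, ξ t ω) atTop (𝓝 l) := by
  have hbdd : ∀ t ω, ‖ξ t ω‖ ≤ √K := fun t ω => Real.abs_le_sqrt <|
    (Finset.single_le_sum (f := fun t => ξ t ω ^ 2) (fun _ _ => sq_nonneg _)
      (Finset.self_mem_range_succ t)).trans (hK (t + 1) ω)
  have hL2 : ∀ t, MemLp (ξ t) 2 P := fun t =>
    .of_bound ((hm t).mono (ℱ.le _)).aestronglyMeasurable _ (ae_of_all _ (hbdd t))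
  refine ae_exists_tendsto_sum_range_of_condExp_eq_zero hm hL2 hcond (K := P.real Set.univ * K)
    fun n => ?_
  rw [← integral_finsetSum _ fun t _ => (hL2 t).integrable_sq]
  refine (integral_mono (integrable_finsetSum _ fun t _ => (hL2 t).integrable_sq)
    (integrable_const K) (hK n)).trans_eq ?_
  rw [integral_const, smul_eq_mul]

theorem ae_tendsto_sum_indicator_of_le_condProb {E : ℕ → Set Ω}
    (hE : ∀ t, MeasurableSet[ℱ (t + 1)] (E t)) {δ : ℝ} (hδ : 0 < δ)
    (hδE : ∀ t, ∀ᵐ ω ∂P, δ ≤ (P⟦E t | ℱ t⟧) ω) {w : ℕ → ℝ} (hw0 : ∀ t, 0 ≤ w t) {R : NNReal}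
    (hwR : ∀ t, w t ≤ R) (hw : Tendsto (fun n => ∑ t ∈ Finset.range n, w t) atTop atTop) :
    ∀ᵐ ω ∂P, Tendsto (fun n => ∑ t ∈ Finset.range n, (E t).indicator (fun _ => w t) ω)
      atTop atTop := by
  set f : ℕ → Ω → ℝ := fun n ω => ∑ t ∈ Finset.range n, (E t).indicator (fun _ => w t) ω with hf
  have hind : ∀ t, (0 : Ω → ℝ) ≤ (E t).indicator fun _ => w t := fun t =>
    Set.indicator_nonneg fun _ _ => hw0 t
  have hdiff : ∀ n, f (n + 1) - f n = w n • (E n).indicator fun _ => (1 : ℝ) := fun n => by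
    ext ω
    by_cases hω : ω ∈ E n <;> simp [hf, Finset.sum_range_succ, hω]
  have hadapted : StronglyAdapted ℱ f := fun n =>
    Finset.stronglyMeasurable_fun_sum (m := ℱ n) _ fun t ht =>
      stronglyMeasurable_const.indicator (ℱ.mono (Finset.mem_range.1 ht) _ (hE t))
  have hint : ∀ n, Integrable (f n) P := fun n =>
    integrable_finsetSum _ fun t _ => (integrable_const _).indicator (ℱ.le _ _ (hE t))
  have hiff := tendsto_sum_indicator_atTop_iff (R := R)
    (ae_of_all P fun ω n => by
      simpa [hf, Finset.sum_range_succ] using hind n ω) hadapted hint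
    (ae_of_all P fun ω n => by
      simpa [hf, Finset.sum_range_succ, abs_of_nonneg (hind n ω)] using
        (Set.indicator_le_self' (fun _ _ => hw0 n) ω).trans (hwR n))
  have hcond : ∀ t, P[f (t + 1) - f t | ℱ t] =ᵐ[P] w t • P⟦E t | ℱ t⟧ := fun t => by
    rw [hdiff]
    exact condExp_smul _ _ _
  filter_upwards [hiff, ae_all_iff.2 hcond, ae_all_iff.2 hδE] with ω hω hcondω hδω
  refine hω.2 (tendsto_atTop_mono (fun n => ?_) (hw.atTop_mul_const hδ))
  simp only [predictablePart, Finset.sum_apply, Finset.sum_mul, hcondω, Pi.smul_apply,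
    smul_eq_mul]
  gcongr with t
  · exact hw0 t
  · exact hδω t

end MartingaleDifferences

/-! ### Functions of a conditionally independent choice -/

section ConditionalLaw

variable {Ω E ι : Type*} {m mΩ : MeasurableSpace Ω} {P : Measure Ω} [IsFiniteMeasure P]
  [MeasurableSpace E] {X : Ω → E} {I : Ω → ι} {ν : ι → Measure E}
  [∀ i, IsFiniteMeasure (ν i)]

theorem map_restrict_of_condLaw (hm : m ≤ mΩ) (hX : Measurable X)
    (hlaw : ∀ B, MeasurableSet B → P⟦X ⁻¹' B | m⟧ =ᵐ[P] fun ω => (ν (I ω)).real B)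
    {D : Set Ω} (hD : MeasurableSet[m] D) {i : ι} (hDi : ∀ ω ∈ D, I ω = i) :
    (P.restrict D).map X = P D • ν i := by
  have hD' : MeasurableSet D := hm D hD
  ext B hB
  have hXB : MeasurableSet (X ⁻¹' B) := hX hB
  have hreal : P.real (X ⁻¹' B ∩ D) = P.real D * (ν i).real B :=
    calc P.real (X ⁻¹' B ∩ D)
        = ∫ ω in D, (X ⁻¹' B).indicator (fun _ => (1 : ℝ)) ω ∂P := by
          rw [integral_indicator_const _ hXB, measureReal_restrict_apply hXB, smul_eq_mul, mul_one]
      _ = ∫ ω in D, (P⟦X ⁻¹' B | m⟧) ω ∂P :=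
          (setIntegral_condExp hm ((integrable_const _).indicator hXB) hD).symm
      _ = ∫ _ in D, (ν i).real B ∂P := by
          refine setIntegral_congr_ae hD' ?_
          filter_upwards [hlaw B hB] with ω hω hωD
          rw [hω, hDi ω hωD]
      _ = P.real D * (ν i).real B := by rw [setIntegral_const, smul_eq_mul]
  rw [Measure.map_apply hX hB, Measure.restrict_apply hXB, Measure.smul_apply, smul_eq_mul,
    ← ENNReal.toReal_eq_toReal_iff' (measure_ne_top _ _)
      (ENNReal.mul_ne_top (measure_ne_top _ _) (measure_ne_top _ _)), ENNReal.toReal_mul]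
  exact hreal

variable {f : ι → E → ℝ}

theorem measurable_comp_choice [Countable ι] (hX : Measurable X)
    (hI : ∀ i, MeasurableSet {ω | I ω = i}) (hf : ∀ i, Measurable (f i)) :
    Measurable fun ω => f (I ω) (X ω) := by
  let _ : MeasurableSpace ι := ⊤
  have hI' : Measurable I := measurable_to_countable' hI
  exact (measurable_from_prod_countable_right (f := fun q : ι × E => f q.1 q.2) hf).comp
    (hI'.prodMk hX)

theorem condExp_comp_of_condLaw [Finite ι] (hm : m ≤ mΩ) (hX : Measurable X)
    (hI : ∀ i, MeasurableSet[m] {ω | I ω = i})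
    (hlaw : ∀ B, MeasurableSet B → P⟦X ⁻¹' B | m⟧ =ᵐ[P] fun ω => (ν (I ω)).real B)
    (hf : ∀ i, Measurable (f i)) {C : ℝ} (hC : ∀ i x, |f i x| ≤ C) :
    P[fun ω => f (I ω) (X ω) | m] =ᵐ[P] fun ω => ∫ x, f (I ω) x ∂(ν (I ω)) := by
  let _ : MeasurableSpace ι := ⊤
  have : Fintype ι := Fintype.ofFinite ι
  have hI' : Measurable[m] I := @measurable_to_countable' ι Ω _ _ m I hI
  have hmean : StronglyMeasurable[m] fun ω => ∫ x, f (I ω) x ∂(ν (I ω)) :=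
    (StronglyMeasurable.of_discrete (f := fun i => ∫ x, f i x ∂(ν i))).comp_measurable hI'
  have hmean_int : Integrable (fun ω => ∫ x, f (I ω) x ∂(ν (I ω))) P :=
    (Integrable.of_finite (μ := P.map I) (f := fun i => ∫ x, f i x ∂(ν i))).comp_measurable
      (hI'.mono hm le_rfl)
  have hint : Integrable (fun ω => f (I ω) (X ω)) P :=
    Integrable.of_bound (measurable_comp_choice hX (fun i => hm _ (hI i)) hf).aestronglyMeasurable
      C (ae_of_all _ fun ω => hC _ _)
  refine (ae_eq_condExp_of_forall_setIntegral_eq hm hint (fun _ _ _ => hmean_int.integrableOn)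
    (fun D hD _ => ?_) hmean.aestronglyMeasurable).symm
  have hcell : ∀ i, MeasurableSet[m] (D ∩ {ω | I ω = i}) := fun i => hD.inter (hI i)
  have hD_eq : D = ⋃ i, D ∩ {ω | I ω = i} := by ext; simp
  have hdisj : Pairwise (Function.onFun Disjoint fun i => D ∩ {ω | I ω = i}) :=
    fun i j hij => Set.disjoint_left.2 fun ω hi hj => hij (hi.2.symm.trans hj.2)
  rw [hD_eq,
    integral_iUnion_fintype (fun i => hm _ (hcell i)) hdisj fun _ => hmean_int.integrableOn,
    integral_iUnion_fintype (fun i => hm _ (hcell i)) hdisj fun _ => hint.integrableOn]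
  refine Finset.sum_congr rfl fun i _ => ?_
  calc ∫ ω in D ∩ {ω | I ω = i}, ∫ x, f (I ω) x ∂(ν (I ω)) ∂P
      = ∫ _ in D ∩ {ω | I ω = i}, ∫ x, f i x ∂(ν i) ∂P :=
        setIntegral_congr_fun (hm _ (hcell i)) fun ω hω => by simp only [hω.2.out]
    _ = ∫ x, f i x ∂((P.restrict (D ∩ {ω | I ω = i})).map X) := by
        rw [map_restrict_of_condLaw hm hX hlaw (hcell i) fun ω hω => hω.2, setIntegral_const,
          integral_smul_measure]
        rfl
    _ = ∫ ω in D ∩ {ω | I ω = i}, f i (X ω) ∂P :=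
        integral_map hX.aemeasurable (hf i).aestronglyMeasurable
    _ = ∫ ω in D ∩ {ω | I ω = i}, f (I ω) (X ω) ∂P :=
        setIntegral_congr_fun (hm _ (hcell i)) fun ω hω => by simp only [hω.2.out]

end ConditionalLaw

namespace DiscountedMDP

variable {S : Type*} {A : S → Type*} (M : DiscountedMDP S A)

/-! ### Bellman operators -/

theorem hasSum_discount_pow : HasSum (fun m => M.discount ^ m) (1 - M.discount)⁻¹ :=
  hasSum_geometric_of_lt_one M.discount_pos.le M.discount_lt_one

section Bellman

variable [Fintype S]

theorem sum_toReal_P (i : S) (u : A i) : ∑ j, (M.P i u j).toReal = 1 := by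
  have h := (M.P i u).tsum_coe
  rw [tsum_fintype] at h
  rw [← ENNReal.toReal_sum fun j _ => (M.P i u).apply_ne_top j, h, ENNReal.toReal_one]

theorem bellman_sub_bellman (π : ∀ i, A i) (J J' : S → ℝ) (i : S) :
    M.bellman π J i - M.bellman π J' i =
      M.discount * ∑ j, (M.P i (π i) j).toReal * (J j - J' j) := by
  simp only [bellman, mul_sub, Finset.sum_sub_distrib]
  ring

theorem bellman_mono (π : ∀ i, A i) : Monotone (M.bellman π) := fun J J' hJ i => by
  have := M.discount_pos.le
  unfold bellman
  gcongr with j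
  exact hJ j

theorem contractingWith_bellman (π : ∀ i, A i) :
    ContractingWith ⟨M.discount, M.discount_pos.le⟩ (M.bellman π) := by
  refine ⟨M.discount_lt_one, LipschitzWith.of_dist_le_mul fun J J' => ?_⟩
  refine (dist_pi_le_iff (mul_nonneg M.discount_pos.le dist_nonneg)).2 fun i => ?_
  rw [Real.dist_eq, bellman_sub_bellman, abs_mul, abs_of_pos M.discount_pos]
  refine mul_le_mul_of_nonneg_left ?_ M.discount_pos.le
  calc |∑ j, (M.P i (π i) j).toReal * (J j - J' j)|
      ≤ ∑ j, |(M.P i (π i) j).toReal * (J j - J' j)| := Finset.abs_sum_le_sum_abs _ _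
    _ = ∑ j, (M.P i (π i) j).toReal * dist (J j) (J' j) := by
        simp only [abs_mul, abs_of_nonneg ENNReal.toReal_nonneg, Real.dist_eq]
    _ ≤ ∑ j, (M.P i (π i) j).toReal * dist J J' := by
        gcongr with j
        exact dist_le_pi_dist J J' j
    _ = dist J J' := by rw [← Finset.sum_mul, sum_toReal_P, one_mul]

theorem exists_bellman_le [∀ i, Finite (A i)] [∀ i, Nonempty (A i)] (J : S → ℝ) :
    ∃ π : ∀ i, A i, ∀ π', M.bellman π J ≤ M.bellman π' J := by
  choose π hπ using fun i => Finite.exists_min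
    fun u : A i => M.cost i u + M.discount * ∑ j, (M.P i u j).toReal * J j
  exact ⟨π, fun π' i => hπ i (π' i)⟩

/-- The temporal-difference error of `J` on the transition from `i` to `j` under the policy `π`.
Its conditional mean given `i` is the Bellman residual of `J` at `i`. -/
def tdError (π : ∀ i, A i) (J : S → ℝ) (i j : S) : ℝ :=
  M.cost i (π i) + M.discount * J j - J i

theorem abs_tdError_le (π : ∀ i, A i) (J : S → ℝ) (i j : S) :
    |M.tdError π J i j| ≤ ‖fun q : S × S => M.tdError π J q.1 q.2‖ :=
  norm_le_pi_norm (fun q : S × S => M.tdError π J q.1 q.2) (i, j)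

theorem norm_discount_pow_mul_le (g : S → ℝ) (m : ℕ) (i : S) :
    ‖M.discount ^ m * g i‖ ≤ M.discount ^ m * ‖g‖ := by
  have := M.discount_pos.le
  rw [norm_mul, norm_pow, Real.norm_of_nonneg this]
  gcongr
  exact norm_le_pi_norm g i

theorem abs_costFrom_le (π : ∀ i, A i) (N : ℕ) (x : ℕ → S) :
    |M.costFrom π N x| ≤ (1 - M.discount)⁻¹ * ‖fun i => M.cost i (π i)‖ :=
  tsum_of_norm_bounded (M.hasSum_discount_pow.mul_right _) fun m =>
    M.norm_discount_pow_mul_le (fun i => M.cost i (π i)) m (x (N + m))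

end Bellman

theorem summable_discount_pow_mul [Finite S] (g : S → ℝ) (x : ℕ → S) :
    Summable fun m => M.discount ^ m * g (x m) := by
  cases nonempty_fintype S
  exact .of_norm_bounded (M.hasSum_discount_pow.summable.mul_right ‖g‖) fun m =>
    M.norm_discount_pow_mul_le g m (x m)

/-- Telescoping: the terms `J (x m)` of consecutive temporal-difference errors cancel. -/
theorem hasSum_tdError [Finite S] (π : ∀ i, A i) (J : S → ℝ) (N : ℕ) (x : ℕ → S) :
    HasSum (fun m => M.discount ^ m * M.tdError π J (x (N + m)) (x (N + m + 1)))
      (M.costFrom π N x - J (x N)) := by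
  have hcost := (M.summable_discount_pow_mul (fun i => M.cost i (π i)) fun m => x (N + m)).hasSum
  have hJ := (M.summable_discount_pow_mul J fun m => x (N + m)).hasSum
  have hdiff := ((hasSum_nat_add_iff' 1).2 hJ).sub hJ
  convert hcost.add hdiff using 1
  · funext m
    rw [tdError, pow_succ, add_assoc N m 1]
    ring
  · simp only [costFrom, Finset.range_one, Finset.sum_singleton, pow_zero, add_zero, one_mul,
      sub_sub_cancel_left]
    ring

/-! ### Temporal-difference errors along trajectories -/

section Trajectories

variable [MeasurableSpace S]

variable (S) in
/-- The canonical filtration of the space of trajectories: at time `n` the states at times `≤ n`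
are known. -/
abbrev pathFiltration : Filtration ℕ (MeasurableSpace.pi : MeasurableSpace (ℕ → S)) :=
  Filtration.piLE (X := fun _ => S)

theorem measurable_eval_pathFiltration {l n : ℕ} (h : l ≤ n) :
    Measurable[pathFiltration S n] fun x : ℕ → S => x l :=
  (measurable_pi_apply (X := fun _ : Set.Iic n => S) ⟨l, h⟩).comp
    (comap_measurable (Preorder.restrictLe (π := fun _ : ℕ => S) n))

theorem measurable_tdError_eval [Countable S] [MeasurableSingletonClass S]
    (π : ∀ i, A i) (J : S → ℝ) (m : ℕ) :
    Measurable fun x : ℕ → S => M.tdError π J (x m) (x (m + 1)) := by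
  have h : Measurable fun q : S × S => M.tdError π J q.1 q.2 := .of_discrete
  exact h.comp (f := fun x : ℕ → S => (x m, x (m + 1)))
    ((measurable_pi_apply m).prodMk (measurable_pi_apply (m + 1)))

theorem measurable_costFrom [Countable S] [MeasurableSingletonClass S] (π : ∀ i, A i) (N : ℕ) :
    Measurable (M.costFrom π N) := by
  have h : Measurable fun i => M.cost i (π i) := .of_discrete
  exact Measurable.tsum fun m => (h.comp (measurable_pi_apply (N + m))).const_mul _

variable [Fintype S] [MeasurableSingletonClass S]

instance (π : ∀ i, A i) (i : S) : IsProbabilityMeasure (M.trajLaw π i) := by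
  unfold trajLaw
  infer_instance

instance (p : PMF S) (π : ∀ i, A i) : IsProbabilityMeasure (M.chainLaw p π) := by
  have h := p.tsum_coe
  rw [tsum_fintype] at h
  exact ⟨by simp [chainLaw, h]⟩

theorem trajLaw_zero_ae (π : ∀ i, A i) (i : S) : ∀ᵐ x ∂(M.trajLaw π i), x 0 = i := by
  have h := Kernel.traj_map_frestrictLe_apply (X := fun _ => S) (κ := M.historyKernel π) 0 0
    (fun _ => i)
  rw [Kernel.partialTraj_self, Kernel.id_apply] at h
  have hzero : ∀ᵐ y ∂((M.trajLaw π i).map (Preorder.frestrictLe (π := fun _ => S) 0)),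
      y ⟨0, Finset.mem_Iic.2 le_rfl⟩ = i := by
    rw [trajLaw, h, ae_dirac_iff .of_discrete]
  exact ae_of_ae_map (Preorder.measurable_frestrictLe 0).aemeasurable hzero

theorem integral_chainLaw_eq_zero {p : PMF S} {π : ∀ i, A i} {F : (ℕ → S) → ℝ}
    (hF : ∀ i, ∫ x, F x ∂(M.trajLaw π i) = 0) (hint : ∀ i, Integrable F (M.trajLaw π i)) :
    ∫ x, F x ∂(M.chainLaw p π) = 0 := by
  rw [chainLaw, integral_finsetSum_measure fun i _ => (hint i).smul_measure (p.apply_ne_top i)]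
  simp [integral_smul_measure, hF]

theorem condExp_eval_succ (π : ∀ i, A i) (i : S) (m : ℕ) (g : S → ℝ) :
    (M.trajLaw π i)[fun x => g (x (m + 1)) | pathFiltration S m]
      =ᵐ[M.trajLaw π i] fun x => ∑ j, (M.P (x m) (π (x m)) j).toReal * g j := by
  have hg : Measurable g := .of_discrete
  have hint : Integrable (fun x => g (x (m + 1))) (M.trajLaw π i) :=
    .of_bound (hg.comp (measurable_pi_apply _)).aestronglyMeasurable ‖g‖
      (ae_of_all _ fun x => norm_le_pi_norm g _)
  refine (Kernel.condExp_traj (Nat.zero_le m) hint).trans (ae_of_all _ fun x => ?_)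
  calc ∫ y, g (y (m + 1)) ∂(Kernel.traj (X := fun _ => S) (M.historyKernel π) m
        (Preorder.frestrictLe m x))
      = ∫ j, g j ∂(M.historyKernel π m (Preorder.frestrictLe (π := fun _ => S) m x)) := by
        rw [← Kernel.map_traj_succ_self (X := fun _ => S) (κ := M.historyKernel π),
          Kernel.map_apply _ (measurable_pi_apply _),
          integral_map (measurable_pi_apply _).aemeasurable hg.aestronglyMeasurable]
    _ = ∫ j, g j ∂(M.P (x m) (π (x m))).toMeasure := rfl
    _ = ∑ j, (M.P (x m) (π (x m)) j).toReal * g j := PMF.integral_eq_sum _ _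

theorem integrable_tdError_eval (π : ∀ i, A i) (J : S → ℝ) (i : S) (m : ℕ) :
    Integrable (fun x => M.tdError π J (x m) (x (m + 1))) (M.trajLaw π i) :=
  .of_bound (M.measurable_tdError_eval π J m).aestronglyMeasurable _
    (ae_of_all _ fun _ => M.abs_tdError_le π J _ _)

theorem condExp_tdError (π : ∀ i, A i) (J : S → ℝ) (i : S) (m : ℕ) :
    (M.trajLaw π i)[fun x => M.tdError π J (x m) (x (m + 1)) | pathFiltration S m]
      =ᵐ[M.trajLaw π i] fun x => M.bellman π J (x m) - J (x m) := by
  have hpast : StronglyMeasurable[pathFiltration S m] fun x => M.cost (x m) (π (x m)) - J (x m) :=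
    (StronglyMeasurable.of_discrete (f := fun j => M.cost j (π j) - J j)).comp_measurable
      (measurable_eval_pathFiltration le_rfl)
  have hbdd : ∀ g : S → ℝ, ∀ l, Integrable (fun x => g (x l)) (M.trajLaw π i) := fun g l =>
    .of_bound ((measurable_of_finite g).comp (measurable_pi_apply l)).aestronglyMeasurable ‖g‖
      (ae_of_all _ fun x => norm_le_pi_norm g _)
  have hsplit : (fun x : ℕ → S => M.tdError π J (x m) (x (m + 1)))
      = (fun x => M.cost (x m) (π (x m)) - J (x m)) + M.discount • fun x => J (x (m + 1)) := by
    funext x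
    simp only [tdError, Pi.add_apply, Pi.smul_apply, smul_eq_mul]
    ring
  rw [hsplit]
  filter_upwards [condExp_add (hbdd (fun j => M.cost j (π j) - J j) m)
    ((hbdd J (m + 1)).smul M.discount) (pathFiltration S m),
    condExp_smul M.discount (fun x : ℕ → S => J (x (m + 1))) (pathFiltration S m)
      (μ := M.trajLaw π i),
    M.condExp_eval_succ π i m J] with x hadd hsmul hnext
  rw [hadd, Pi.add_apply, hsmul, Pi.smul_apply, hnext, bellman,
    condExp_of_stronglyMeasurable ((pathFiltration S).le m) hpast
      (hbdd (fun j => M.cost j (π j) - J j) m)]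
  simp only [smul_eq_mul]
  ring

theorem integrable_costFrom (π : ∀ i, A i) (N : ℕ) (i : S) :
    Integrable (M.costFrom π N) (M.trajLaw π i) :=
  .of_bound (M.measurable_costFrom π N).aestronglyMeasurable _
    (ae_of_all _ fun x => M.abs_costFrom_le π N x)

theorem setIntegral_costFrom_sub_eq_zero {π : ∀ i, A i} {J : S → ℝ} (hJ : M.bellman π J = J)
    (i : S) {N : ℕ} {E : Set (ℕ → S)} (hE : MeasurableSet[pathFiltration S N] E) :
    ∫ x in E, (M.costFrom π N x - J (x N)) ∂(M.trajLaw π i) = 0 := by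
  have hzero : ∀ m, ∫ x in E, M.tdError π J (x (N + m)) (x (N + m + 1)) ∂(M.trajLaw π i) = 0 :=
    fun m => by
      rw [← setIntegral_condExp ((pathFiltration S).le (N + m)) (M.integrable_tdError_eval π J i _)
        ((pathFiltration S).mono (Nat.le_add_right N m) E hE)]
      refine integral_eq_zero_of_ae (ae_restrict_of_ae ?_)
      filter_upwards [M.condExp_tdError π J i (N + m)] with x hx
      simp [hx, hJ]
  have hint : ∀ m, Integrable (fun x : ℕ → S => M.discount ^ m *
      M.tdError π J (x (N + m)) (x (N + m + 1))) ((M.trajLaw π i).restrict E) := fun m =>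
    ((M.integrable_tdError_eval π J i (N + m)).restrict (s := E)).const_mul _
  have hsum : Summable fun m => ∫ x in E, ‖M.discount ^ m *
      M.tdError π J (x (N + m)) (x (N + m + 1))‖ ∂(M.trajLaw π i) := by
    refine .of_nonneg_of_le (fun m => integral_nonneg fun x => norm_nonneg _) (fun m => ?_)
      ((M.hasSum_discount_pow.summable.mul_right
        ‖fun q : S × S => M.tdError π J q.1 q.2‖).mul_right ((M.trajLaw π i).real E))
    refine (integral_mono (hint m).norm (integrable_const _) fun x => ?_).trans_eq
      (by rw [setIntegral_const, smul_eq_mul, mul_comm])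
    have := M.discount_pos.le
    simp only [norm_mul, norm_pow, Real.norm_of_nonneg this]
    gcongr
    exact M.abs_tdError_le π J _ _
  simpa only [integral_const_mul, hzero, mul_zero, tsum_zero, (M.hasSum_tdError π J N _).tsum_eq]
    using (integral_tsum_of_summable_integral_norm hint hsum).symm

/-! ### Value functions -/

theorem value_eq_of_bellman_eq {π : ∀ i, A i} {J : S → ℝ} (hJ : M.bellman π J = J) :
    M.value π = J := by
  funext i
  have h := M.setIntegral_costFrom_sub_eq_zero hJ i (N := 0) MeasurableSet.univ
  have hstart : ∫ x, (M.costFrom π 0 x - J (x 0)) ∂(M.trajLaw π i) = M.value π i - J i := by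
    calc ∫ x, (M.costFrom π 0 x - J (x 0)) ∂(M.trajLaw π i)
        = ∫ x, (M.costFrom π 0 x - J i) ∂(M.trajLaw π i) :=
          integral_congr_ae ((M.trajLaw_zero_ae π i).mono fun x hx => by simp only [hx])
      _ = M.value π i - J i := by
          rw [integral_sub (M.integrable_costFrom π 0 i) (integrable_const _)]
          simp [value]
  rw [setIntegral_univ, hstart] at h
  exact sub_eq_zero.1 h

theorem bellman_value (π : ∀ i, A i) : M.bellman π (M.value π) = M.value π := by
  have hfix := (M.contractingWith_bellman π).fixedPoint_isFixedPt
  rw [M.value_eq_of_bellman_eq hfix]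
  exact hfix

theorem le_value_of_le_bellman {π : ∀ i, A i} {J : S → ℝ} (hJ : J ≤ M.bellman π J) :
    J ≤ M.value π :=
  le_fixedPoint_of_le_map (M.contractingWith_bellman π) (M.bellman_mono π) (M.bellman_value π) hJ

theorem value_le_of_bellman_le {π : ∀ i, A i} {J : S → ℝ} (hJ : M.bellman π J ≤ J) :
    M.value π ≤ J :=
  fixedPoint_le_of_map_le (M.contractingWith_bellman π) (M.bellman_mono π) (M.bellman_value π) hJ

section Optimal

variable [∀ i, Finite (A i)]

theorem optValue_le_value (π : ∀ i, A i) : M.optValue ≤ M.value π := fun _ =>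
  ciInf_le (Set.finite_range _).bddBelow π

theorem value_eq_optValue {π : ∀ i, A i} (hπ : ∀ π', M.value π ≤ M.bellman π' (M.value π)) :
    M.value π = M.optValue :=
  have : Nonempty (∀ i, A i) := ⟨π⟩
  le_antisymm (fun i => le_ciInf fun π' => M.le_value_of_le_bellman (hπ π') i)
    (M.optValue_le_value π)

variable [∀ i, Nonempty (A i)]

/-- Policy improvement: a policy with the least total value cannot be improved. -/
theorem exists_value_le_bellman_value :
    ∃ π : ∀ i, A i, ∀ π', M.value π ≤ M.bellman π' (M.value π) := by
  obtain ⟨π, hπ⟩ := Finite.exists_min fun π : ∀ i, A i => ∑ i, M.value π i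
  obtain ⟨ρ, hρ⟩ := M.exists_bellman_le (M.value π)
  have hle : M.value ρ ≤ M.value π :=
    M.value_le_of_bellman_le ((hρ π).trans_eq (M.bellman_value π))
  have heq : M.value ρ = M.value π := funext fun i =>
    (Finset.sum_eq_sum_iff_of_le fun i _ => hle i).1
      (le_antisymm (Finset.sum_le_sum fun i _ => hle i) (hπ ρ)) i (Finset.mem_univ i)
  refine ⟨π, fun π' => ?_⟩
  calc M.value π = M.bellman ρ (M.value π) := by rw [← heq, bellman_value]
    _ ≤ M.bellman π' (M.value π) := hρ π'

theorem exists_bellman_optValue_eq : ∃ π : ∀ i, A i, M.bellman π M.optValue = M.optValue := by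
  obtain ⟨π, hπ⟩ := M.exists_value_le_bellman_value
  exact ⟨π, M.value_eq_optValue hπ ▸ M.bellman_value π⟩

theorem optValue_le_bellman_optValue (π : ∀ i, A i) : M.optValue ≤ M.bellman π M.optValue := by
  obtain ⟨ρ, hρ⟩ := M.exists_value_le_bellman_value
  exact M.value_eq_optValue hρ ▸ hρ π

end Optimal

end Trajectories

/-! ### First visits -/

section Visits

variable {k : ℕ} {cl : S → Fin k} {x : ℕ → S} {c : Fin k}

theorem Visits.cl_firstVisit (h : Visits cl x c) : cl (x (firstVisit cl x c)) = c := Nat.sInf_mem h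

theorem firstVisit_eq_iff {N : ℕ} (h : Visits cl x c) :
    firstVisit cl x c = N ↔ cl (x N) = c ∧ ∀ l < N, cl (x l) ≠ c := by
  constructor
  · rintro rfl
    exact ⟨h.cl_firstVisit, fun l hl => Nat.notMem_of_lt_sInf hl⟩
  · rintro ⟨hN, hlt⟩
    exact le_antisymm (Nat.sInf_le hN) (not_lt.1 fun hl => hlt _ hl h.cl_firstVisit)

theorem firstVisit_of_not_visits (h : ¬ Visits cl x c) : firstVisit cl x c = 0 :=
  Nat.sInf_eq_zero.2 (.inr (Set.eq_empty_of_forall_notMem fun m hm => h ⟨m, hm⟩))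

variable (cl c)

theorem visits_eq_iUnion :
    {x : ℕ → S | Visits cl x c} = ⋃ N, {x | Visits cl x c ∧ firstVisit cl x c = N} := by
  ext x
  simp

variable [MeasurableSpace S] [DiscreteMeasurableSpace S]

theorem measurableSet_firstVisit_eq (N : ℕ) :
    MeasurableSet[pathFiltration S N] {x | Visits cl x c ∧ firstVisit cl x c = N} := by
  have heval : ∀ l ≤ N, MeasurableSet[pathFiltration S N] {x : ℕ → S | cl (x l) = c} :=
    fun l hl => measurable_eval_pathFiltration hl (.of_discrete (s := {i | cl i = c}))
  have heq : {x : ℕ → S | Visits cl x c ∧ firstVisit cl x c = N} =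
      {x | cl (x N) = c} ∩ ⋂ l, ⋂ _ : l < N, {x | cl (x l) = c}ᶜ := by
    ext x
    simp only [Set.mem_inter_iff, Set.mem_iInter, Set.mem_compl_iff, Set.mem_ofPred_eq]
    exact ⟨fun ⟨h, hN⟩ => (firstVisit_eq_iff h).1 hN,
      fun h => ⟨⟨N, h.1⟩, (firstVisit_eq_iff ⟨N, h.1⟩).2 h⟩⟩
  rw [heq]
  exact (heval N le_rfl).inter (.iInter fun l => .iInter fun hl => (heval l hl.le).compl)

theorem measurableSet_visits : MeasurableSet {x : ℕ → S | Visits cl x c} := by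
  rw [visits_eq_iUnion]
  exact .iUnion fun N => (pathFiltration S).le N _ (measurableSet_firstVisit_eq cl c N)

theorem measurableSet_preimage_firstVisit (N : ℕ) :
    MeasurableSet {x : ℕ → S | firstVisit cl x c = N} := by
  have heq : {x : ℕ → S | firstVisit cl x c = N} =
      {x | Visits cl x c ∧ firstVisit cl x c = N} ∪ {x | ¬ Visits cl x c ∧ 0 = N} := by
    ext x
    by_cases h : Visits cl x c
    · simp [h]
    · simp [h, firstVisit_of_not_visits h]
  rw [heq]
  exact ((pathFiltration S).le N _ (measurableSet_firstVisit_eq cl c N)).union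
    ((measurableSet_visits cl c).compl.inter (.const _))

end Visits

/-! ### The noise of an update -/

section VisitNoise

variable [Fintype S] [MeasurableSpace S] [MeasurableSingletonClass S]
  {k : ℕ} (cl : S → Fin k) (c : Fin k) (π : ∀ i, A i)

/-- The error of the cost simulated from the first visit to the cluster `c` on, as an estimate of
the value of `π` at the state in which `c` is entered; it is zero if `c` is not visited. -/
noncomputable def visitNoise : (ℕ → S) → ℝ :=
  {x | Visits cl x c}.indicator fun x =>
    M.tailCost cl π x c - M.value π (x (firstVisit cl x c))

theorem abs_visitNoise_le (x : ℕ → S) : |M.visitNoise cl c π x| ≤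
    (1 - M.discount)⁻¹ * ‖fun i => M.cost i (π i)‖ + ‖M.value π‖ := by
  refine (norm_indicator_le_norm_self (fun x => M.tailCost cl π x c - M.value π _) x).trans
    ((norm_sub_le _ _).trans ?_)
  exact add_le_add (M.abs_costFrom_le π _ x) (norm_le_pi_norm (M.value π) _)

theorem exists_abs_visitNoise_le [∀ i, Finite (A i)] :
    ∃ D, ∀ π x, |M.visitNoise cl c π x| ≤ D := by
  obtain ⟨D, hD⟩ := (Set.finite_range fun π : ∀ i, A i =>
    (1 - M.discount)⁻¹ * ‖fun i => M.cost i (π i)‖ + ‖M.value π‖).bddAbove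
  exact ⟨D, fun π x => (M.abs_visitNoise_le cl c π x).trans (hD ⟨π, rfl⟩)⟩

theorem measurable_visitNoise : Measurable (M.visitNoise cl c π) :=
  (measurable_comp_choice (X := id) measurable_id (measurableSet_preimage_firstVisit cl c)
    (f := fun N x => M.costFrom π N x - M.value π (x N)) fun N =>
      (M.measurable_costFrom π N).sub
        ((measurable_of_finite (M.value π)).comp (measurable_pi_apply N))).indicator
    (measurableSet_visits cl c)

theorem integrable_visitNoise (i : S) : Integrable (M.visitNoise cl c π) (M.trajLaw π i) :=
  .of_bound (M.measurable_visitNoise cl c π).aestronglyMeasurable _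
    (ae_of_all _ fun x => M.abs_visitNoise_le cl c π x)

theorem integral_trajLaw_visitNoise (i : S) : ∫ x, M.visitNoise cl c π x ∂(M.trajLaw π i) = 0 := by
  have hmeas : ∀ N, MeasurableSet {x : ℕ → S | Visits cl x c ∧ firstVisit cl x c = N} := fun N =>
    (pathFiltration S).le N _ (measurableSet_firstVisit_eq cl c N)
  have hdisj : Pairwise (Function.onFun Disjoint
      fun N => {x : ℕ → S | Visits cl x c ∧ firstVisit cl x c = N}) := fun N N' hne =>
    Set.disjoint_left.2 fun x h h' => hne (h.2.symm.trans h'.2)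
  have hunion : ∫ x, M.visitNoise cl c π x ∂(M.trajLaw π i) =
      ∫ x in ⋃ N, {x | Visits cl x c ∧ firstVisit cl x c = N},
        M.visitNoise cl c π x ∂(M.trajLaw π i) := by
    rw [← visits_eq_iUnion, setIntegral_eq_integral_of_forall_compl_eq_zero]
    exact fun x hx => Set.indicator_of_notMem hx _
  rw [hunion, integral_iUnion hmeas hdisj (M.integrable_visitNoise cl c π i).integrableOn]
  refine (tsum_congr fun N => ?_).trans tsum_zero
  rw [← M.setIntegral_costFrom_sub_eq_zero (M.bellman_value π) i
    (measurableSet_firstVisit_eq cl c N)]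
  refine setIntegral_congr_fun (hmeas N) fun x ⟨hx, hN⟩ => ?_
  simp only [visitNoise, Set.indicator_of_mem (s := {x | Visits cl x c}) hx, tailCost, hN]

theorem integral_chainLaw_visitNoise (p : PMF S) :
    ∫ x, M.visitNoise cl c π x ∂(M.chainLaw p π) = 0 :=
  M.integral_chainLaw_eq_zero (M.integral_trajLaw_visitNoise cl c π)
    (M.integrable_visitNoise cl c π)

end VisitNoise

variable {M}

/-! ### Levels of the reachability graph -/

theorem edge_of_ne_zero {i j : S} {u : A i} (h : M.P i u j ≠ 0) : M.Edge i j :=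
  ⟨u, pos_iff_ne_zero.2 h⟩

variable (M) in
theorem exists_edge [∀ i, Nonempty (A i)] (i : S) : ∃ j, M.Edge i j := by
  obtain ⟨u⟩ := ‹∀ i, Nonempty (A i)› i
  obtain ⟨j, hj⟩ := (M.P i u).support_nonempty
  exact ⟨j, edge_of_ne_zero ((PMF.mem_support_iff _ _).1 hj)⟩

theorem IsAbsorbing.P_eq_pure {i : S} (hi : M.IsAbsorbing i) (u : A i) : M.P i u = PMF.pure i := by
  have hsupp := (PMF.apply_eq_one_iff _ _).1 (hi u)
  ext j
  by_cases hj : j = i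
  · simp [hj, hi u]
  · rw [PMF.pure_apply_of_ne _ _ hj, PMF.apply_eq_zero_iff, hsupp]
    exact hj

theorem IsAbsorbing.eq_of_edge {i j : S} (hi : M.IsAbsorbing i) (h : M.Edge i j) : j = i := by
  obtain ⟨u, hu⟩ := h
  by_contra hj
  rw [hi.P_eq_pure, PMF.pure_apply_of_ne _ _ hj] at hu
  exact hu.false

variable (M) in
/-- A function that decreases along the edges leaving the states that are not absorbing. Backward
induction on such a function replaces the finite horizon of a problem that stops. -/
def IsLevelFunction (level : S → ℕ) : Prop :=
  ∀ ⦃i j⦄, ¬ M.IsAbsorbing i → M.Edge i j → level j < level i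

variable (M) in
/-- The edges of the subgraph induced by the transient states. -/
def TransientEdge (i j : S) : Prop := M.IsTransient i ∧ M.IsTransient j ∧ M.Edge i j

theorem transientEdge_of_reaches (h_absorbing : ∀ i, ¬ M.IsTransient i → M.IsAbsorbing i)
    {i j : S} (hj : M.IsTransient j) (h : M.Reaches i j) :
    M.IsTransient i ∧ Relation.ReflTransGen M.TransientEdge i j := by
  induction h using Relation.ReflTransGen.head_induction_on with
  | refl => exact ⟨hj, .refl⟩
  | @head a b hab _ ih =>
    have ha : M.IsTransient a := by
      by_contra ha
      exact ha ((h_absorbing a ha).eq_of_edge hab ▸ ih.1)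
    exact ⟨ha, .head ⟨ha, ih.1, hab⟩ ih.2⟩

theorem not_reaches_of_edge (h_acyclic : M.TransientAcyclic)
    (h_absorbing : ∀ i, ¬ M.IsTransient i → M.IsAbsorbing i)
    {i j : S} (hi : M.IsTransient i) (hij : M.Edge i j) : ¬ M.Reaches j i := fun h => by
  obtain ⟨hj, hji⟩ := transientEdge_of_reaches h_absorbing hi h
  exact h_acyclic i (Relation.TransGen.head' ⟨hi, hj, hij⟩ hji)

theorem reaches_of_path {l : ℕ} {x : Fin (l + 1) → S}
    (hx : ∀ m : Fin l, M.Edge (x m.castSucc) (x m.succ)) (m : Fin (l + 1)) :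
    M.Reaches (x 0) (x m) := by
  induction m using Fin.induction with
  | zero => exact .refl
  | succ m ih => exact ih.tail (hx m)

theorem PathToAbsorbing.cons {i j : S} {l : ℕ} (h : M.PathToAbsorbing j l) (hij : M.Edge i j)
    (hji : ¬ M.Reaches j i) : M.PathToAbsorbing i (l + 1) := by
  obtain ⟨x, hx, rfl, hxl, hxe⟩ := h
  refine ⟨Fin.cons i x, Fin.cons_injective_iff.2 ⟨?_, hx⟩, by simp, ?_, fun m => ?_⟩
  · rintro ⟨m, rfl⟩
    exact hji (reaches_of_path hxe m)
  · rwa [← Fin.succ_last, Fin.cons_succ]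
  · induction m using Fin.cases with
    | zero => simpa using hij
    | succ m =>
      rw [← Fin.succ_castSucc, Fin.cons_succ, Fin.cons_succ]
      exact hxe m

theorem IsAbsorbing.pathToAbsorbing_zero {i : S} (hi : M.IsAbsorbing i) :
    M.PathToAbsorbing i 0 :=
  ⟨fun _ => i, fun a b _ => Subsingleton.elim (α := Fin 1) a b, rfl, hi, fun m => m.elim0⟩

theorem bddAbove_pathToAbsorbing [Finite S] (i : S) : BddAbove {l | M.PathToAbsorbing i l} := by
  refine ⟨Nat.card S, fun l ⟨x, hx, _⟩ => ?_⟩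
  have h := Nat.card_le_card_of_injective x hx
  rw [Nat.card_fin] at h
  omega

theorem exists_pathToAbsorbing [Finite S] [∀ i, Nonempty (A i)] (h_acyclic : M.TransientAcyclic)
    (h_absorbing : ∀ i, ¬ M.IsTransient i → M.IsAbsorbing i) (i : S) :
    ∃ l, M.PathToAbsorbing i l := by
  have : Std.Irrefl (Relation.TransGen (Function.swap M.TransientEdge)) :=
    ⟨fun a h => h_acyclic a (Relation.transGen_swap.1 h)⟩
  have hwf : WellFounded (Relation.TransGen (Function.swap M.TransientEdge)) :=
    Finite.wellFounded_of_trans_of_irrefl _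
  induction i using hwf.induction with
  | _ i ih =>
    by_cases hi : M.IsTransient i
    · obtain ⟨j, hij⟩ := M.exists_edge i
      have hj : ∃ l, M.PathToAbsorbing j l := by
        by_cases hj : M.IsTransient j
        · exact ih j (.single ⟨hi, hj, hij⟩)
        · exact ⟨0, (h_absorbing j hj).pathToAbsorbing_zero⟩
      obtain ⟨l, hl⟩ := hj
      exact ⟨l + 1, hl.cons hij (not_reaches_of_edge h_acyclic h_absorbing hi hij)⟩
    · exact ⟨0, (h_absorbing i hi).pathToAbsorbing_zero⟩

theorem isLevelFunction_maxDist [Finite S] [∀ i, Nonempty (A i)] (h_acyclic : M.TransientAcyclic)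
    (h_absorbing : ∀ i, ¬ M.IsTransient i → M.IsAbsorbing i) : M.IsLevelFunction M.maxDist := by
  intro i j hi hij
  have hit : M.IsTransient i := not_not.1 (mt (h_absorbing i) hi)
  have hj : M.PathToAbsorbing j (M.maxDist j) :=
    Nat.sSup_mem (exists_pathToAbsorbing h_acyclic h_absorbing j) (bddAbove_pathToAbsorbing j)
  exact le_csSup (bddAbove_pathToAbsorbing i)
    (hj.cons hij (not_reaches_of_edge h_acyclic h_absorbing hit hij))

/-! ### Optimality up to a level -/

section Optimality

variable [Fintype S]

theorem IsAbsorbing.bellman_eq {i : S} (hi : M.IsAbsorbing i) (π : ∀ i, A i) (J : S → ℝ) :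
    M.bellman π J i = M.cost i (π i) + M.discount * J i := by
  classical
  simp [bellman, hi.P_eq_pure, PMF.pure_apply, apply_ite ENNReal.toReal]

theorem bellman_congr_of_edge {π : ∀ i, A i} {i : S} {J J' : S → ℝ}
    (h : ∀ j, M.Edge i j → J j = J' j) : M.bellman π J i = M.bellman π J' i := by
  unfold bellman
  congr 2
  refine Finset.sum_congr rfl fun j _ => ?_
  by_cases h0 : M.P i (π i) j = 0
  · simp [h0]
  · rw [h j (edge_of_ne_zero h0)]

theorem tendsto_bellman_of_edge {α : Type*} {l : Filter α} {π : ∀ i, A i} {i : S}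
    {J : α → S → ℝ} {J' : S → ℝ} (h : ∀ j, M.Edge i j → Tendsto (fun t => J t j) l (𝓝 (J' j))) :
    Tendsto (fun t => M.bellman π (J t) i) l (𝓝 (M.bellman π J' i)) := by
  unfold bellman
  refine tendsto_const_nhds.add (Tendsto.const_mul _ (tendsto_finsetSum _ fun j _ => ?_))
  by_cases h0 : M.P i (π i) j = 0
  · simp [h0, tendsto_const_nhds]
  · exact (h j (edge_of_ne_zero h0)).const_mul _

variable {level : S → ℕ} {d : ℕ}

theorem IsLevelFunction.eq_of_bellman_eq (hlevel : M.IsLevelFunction level) {π : ∀ i, A i}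
    {J J' : S → ℝ} (hJ : ∀ i, level i ≤ d → M.bellman π J i = J i)
    (hJ' : ∀ i, level i ≤ d → M.bellman π J' i = J' i) (i : S) (hi : level i ≤ d) :
    J i = J' i := by
  induction h : level i using Nat.strong_induction_on generalizing i with
  | _ e ih =>
    by_cases habs : M.IsAbsorbing i
    · have hJi := hJ i hi
      have hJi' := hJ' i hi
      rw [habs.bellman_eq] at hJi hJi'
      have hprod : (1 - M.discount) * (J i - J' i) = 0 := by linear_combination hJi' - hJi
      exact sub_eq_zero.1 ((mul_eq_zero.1 hprod).resolve_left (sub_pos.2 M.discount_lt_one).ne')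
    · rw [← hJ i hi, ← hJ' i hi]
      refine bellman_congr_of_edge fun j hij => ?_
      have hlt := hlevel habs hij
      exact ih _ (h ▸ hlt) j (hlt.le.trans hi) rfl

theorem IsLevelFunction.eventually_bellman_le [∀ i, Finite (A i)]
    (hlevel : M.IsLevelFunction level) {α : Type*} {l : Filter α} {J : α → S → ℝ} {J' : S → ℝ}
    {μ : α → ∀ i, A i} (hμ : ∀ t π, M.bellman (μ t) (J t) ≤ M.bellman π (J t))
    (hJ : ∀ j, level j < d → Tendsto (fun t => J t j) l (𝓝 (J' j))) :
    ∀ᶠ t in l, ∀ i, level i ≤ d → ∀ π, M.bellman (μ t) J' i ≤ M.bellman π J' i := by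
  refine eventually_all.2 fun i => ?_
  by_cases hi : level i ≤ d
  swap
  · exact .of_forall fun t h => absurd h hi
  by_cases habs : M.IsAbsorbing i
  · refine .of_forall fun t _ π => ?_
    have hcost := hμ t π i
    rw [habs.bellman_eq, habs.bellman_eq] at hcost ⊢
    linarith
  · have hlim : ∀ π, Tendsto (fun t => M.bellman π (J t) i) l (𝓝 (M.bellman π J' i)) := fun π =>
      tendsto_bellman_of_edge fun j hij => hJ j ((hlevel habs hij).trans_le hi)
    filter_upwards [eventually_forall_le_of_tendsto hlim fun t π => hμ t π i] with t ht _
    exact ht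

theorem IsLevelFunction.eventually_value_eq_optValue [MeasurableSpace S]
    [MeasurableSingletonClass S] [∀ i, Finite (A i)] [∀ i, Nonempty (A i)]
    (hlevel : M.IsLevelFunction level) {α : Type*} {l : Filter α} {J : α → S → ℝ}
    {μ : α → ∀ i, A i} (hμ : ∀ t π, M.bellman (μ t) (J t) ≤ M.bellman π (J t))
    (hJ : ∀ j, level j < d → Tendsto (fun t => J t j) l (𝓝 (M.optValue j))) :
    ∀ᶠ t in l, ∀ i, level i ≤ d → M.value (μ t) i = M.optValue i := by
  obtain ⟨ρ, hρ⟩ := M.exists_bellman_optValue_eq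
  filter_upwards [hlevel.eventually_bellman_le hμ hJ] with t ht
  refine hlevel.eq_of_bellman_eq (π := μ t) (fun i _ => congrFun (M.bellman_value (μ t)) i)
    fun i hi => le_antisymm ?_ (M.optValue_le_bellman_optValue (μ t) i)
  exact (ht i hi ρ).trans_eq (congrFun hρ i)

end Optimality

/-! ### Step sizes -/

section StepSizes

variable {k : ℕ} {cl : S → Fin k}

/-- The step size with which the parameter of the cluster `c` is really updated in each iteration,
for the nominal step sizes `g` of `c`: it is zero in the iterations that do not visit `c`. -/
noncomputable def effectiveStep (cl : S → Fin k) (x : ℕ → ℕ → S) (c : Fin k) (g : ℕ → ℝ) : ℕ → ℝ :=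
  {t | Visits cl (x t) c}.indicator g

theorem effectiveStep_of_visits {x : ℕ → ℕ → S} {c : Fin k} {t : ℕ} (h : Visits cl (x t) c)
    (g : ℕ → ℝ) : effectiveStep cl x c g t = g t :=
  Set.indicator_of_mem (s := {t | Visits cl (x t) c}) h g

theorem effectiveStep_of_not_visits {x : ℕ → ℕ → S} {c : Fin k} {t : ℕ}
    (h : ¬ Visits cl (x t) c) (g : ℕ → ℝ) : effectiveStep cl x c g t = 0 :=
  Set.indicator_of_notMem (s := {t | Visits cl (x t) c}) h g

/-- The step sizes `γ` follow the schedule `β` along the iterations, or, separately for each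
cluster, along the iterations that visit it. -/
def IsStepSizeRule {Ω : Type*} (cl : S → Fin k) (β : ℕ → ℝ) (X : ℕ → Ω → ℕ → S)
    (γ : ℕ → Ω → Fin k → ℝ) : Prop :=
  (∀ t ω c, γ t ω c = β t) ∨ (∀ t ω c, γ t ω c = β (visitCount cl (fun τ => X τ ω) t c))

theorem visitCount_eq_sum (x : ℕ → ℕ → S) (n : ℕ) (c : Fin k) :
    visitCount cl x n c = ∑ t ∈ Finset.range n, {x | Visits cl x c}.indicator 1 (x t) := by
  classical
  have heq : {τ | τ < n ∧ Visits cl (x τ) c} =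
      ((Finset.range n).filter fun τ => Visits cl (x τ) c : Finset ℕ) := by
    ext τ
    simp
  rw [visitCount, heq, Set.ncard_coe_finset, Finset.card_filter]
  rfl

theorem sum_effectiveStep_comp_visitCount (x : ℕ → ℕ → S) (c : Fin k) (g : ℕ → ℝ) (n : ℕ) :
    ∑ t ∈ Finset.range n, effectiveStep cl x c (fun t => g (visitCount cl x t c)) t =
      ∑ j ∈ Finset.range (visitCount cl x n c), g j := by
  induction n with
  | zero => simp [visitCount_eq_sum]
  | succ n ih =>
    rw [Finset.sum_range_succ, ih, visitCount_eq_sum x (n + 1), Finset.sum_range_succ,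
      ← visitCount_eq_sum]
    by_cases hn : Visits cl (x n) c <;>
      simp [effectiveStep_of_visits, effectiveStep_of_not_visits, hn, Finset.sum_range_succ]

namespace IsStepSizeRule

variable {Ω : Type*} {X : ℕ → Ω → ℕ → S} {γ : ℕ → Ω → Fin k → ℝ} {β : ℕ → ℝ}

theorem nonneg (h_step : IsStepSizeRule cl β X γ) (hβ : ∀ t, 0 ≤ β t) (t : ℕ) (ω : Ω)
    (c : Fin k) : 0 ≤ γ t ω c := by
  rcases h_step with h | h <;> rw [h] <;> exact hβ _

theorem sum_effectiveStep_sq_le (h_step : IsStepSizeRule cl β X γ)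
    (hβ_sq : Summable fun t => β t ^ 2) (c : Fin k) (n : ℕ) (ω : Ω) :
    ∑ t ∈ Finset.range n, effectiveStep cl (fun τ => X τ ω) c (fun τ => γ τ ω c) t ^ 2 ≤
      ∑' t, β t ^ 2 := by
  have hsq : ∀ g t, effectiveStep cl (fun τ => X τ ω) c g t ^ 2 =
      effectiveStep cl (fun τ => X τ ω) c (fun τ => g τ ^ 2) t := fun g t => by
    by_cases ht : Visits cl (X t ω) c <;>
      simp [effectiveStep_of_visits, effectiveStep_of_not_visits, ht]
  simp only [hsq]
  rcases h_step with h | h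
  · simp only [h]
    exact (Finset.sum_le_sum fun t _ => Set.indicator_le_self' (fun _ _ => sq_nonneg _) t).trans
      (hβ_sq.sum_le_tsum _ fun _ _ => sq_nonneg _)
  · simp only [h]
    rw [sum_effectiveStep_comp_visitCount (fun τ => X τ ω) c fun j => β j ^ 2]
    exact hβ_sq.sum_le_tsum _ fun _ _ => sq_nonneg _

theorem tendsto_effectiveStep (h_step : IsStepSizeRule cl β X γ)
    (hβ_sq : Summable fun t => β t ^ 2) (c : Fin k) (ω : Ω) :
    Tendsto (effectiveStep cl (fun τ => X τ ω) c fun τ => γ τ ω c) atTop (𝓝 0) := by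
  have hsq := (summable_of_sum_range_le (fun _ => sq_nonneg _) fun n =>
    h_step.sum_effectiveStep_sq_le hβ_sq c n ω).tendsto_atTop_zero.sqrt
  simp only [Real.sqrt_sq_eq_abs, Real.sqrt_zero] at hsq
  exact (tendsto_zero_iff_abs_tendsto_zero _).2 hsq

theorem eventually_effectiveStep_mem_Icc (h_step : IsStepSizeRule cl β X γ) (hβ : ∀ t, 0 ≤ β t)
    (hβ_sq : Summable fun t => β t ^ 2) (c : Fin k) (ω : Ω) :
    ∀ᶠ t in atTop,
      effectiveStep cl (fun τ => X τ ω) c (fun τ => γ τ ω c) t ∈ Set.Icc (0 : ℝ) 1 := by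
  filter_upwards [(h_step.tendsto_effectiveStep hβ_sq c ω).eventually_le_const one_pos] with t ht
  exact ⟨Set.indicator_nonneg (fun t _ => h_step.nonneg hβ t ω c) t, ht⟩

theorem sum_mul_visitNoise_sq_le [Fintype S] [MeasurableSpace S] [MeasurableSingletonClass S]
    (h_step : IsStepSizeRule cl β X γ) (hβ_sq : Summable fun t => β t ^ 2) (c : Fin k) {D : ℝ}
    (hD : ∀ π x, |M.visitNoise cl c π x| ≤ D) (μ : ℕ → Ω → ∀ i, A i) (n : ℕ) (ω : Ω) :
    ∑ t ∈ Finset.range n, (γ t ω c * M.visitNoise cl c (μ t ω) (X t ω)) ^ 2 ≤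
      (∑' t, β t ^ 2) * D ^ 2 := by
  refine le_trans ?_
    (mul_le_mul_of_nonneg_right (h_step.sum_effectiveStep_sq_le hβ_sq c n ω) (sq_nonneg D))
  rw [Finset.sum_mul]
  refine Finset.sum_le_sum fun t _ => ?_
  by_cases h : Visits cl (X t ω) c
  · rw [effectiveStep_of_visits h, mul_pow]
    gcongr _ * ?_
    exact sq_le_sq' (neg_le_of_abs_le (hD _ _)) (le_of_abs_le (hD _ _))
  · simp [effectiveStep_of_not_visits, visitNoise, h]

theorem measurable [MeasurableSpace S] [DiscreteMeasurableSpace S] {mΩ : MeasurableSpace Ω}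
    (h_step : IsStepSizeRule cl β X γ) {ℱ : Filtration ℕ mΩ}
    (hX : ∀ t, Measurable[ℱ (t + 1)] (X t)) (t : ℕ) (c : Fin k) :
    Measurable[ℱ t] fun ω => γ t ω c := by
  rcases h_step with h | h
  · simp only [h]
    exact measurable_const
  · simp only [h, visitCount_eq_sum]
    refine Measurable.of_discrete.comp (Finset.measurable_sum (m := ℱ t) _ fun τ hτ => ?_)
    exact (measurable_one.indicator (measurableSet_visits cl c)).comp
      ((hX τ).mono (ℱ.mono (Finset.mem_range.1 hτ)) le_rfl)

end IsStepSizeRule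

end StepSizes

/-! ### Runs of the algorithm -/

namespace IsAggregatedOPI

variable [Fintype S] [MeasurableSpace S] [MeasurableSingletonClass S]
  {k : ℕ} {cl : S → Fin k} {p : PMF S} {θ₀ : Fin k → ℝ}
  {Ω : Type*} {mΩ : MeasurableSpace Ω} {Pr : Measure Ω} {ℱ : Filtration ℕ mΩ}
  {γ : ℕ → Ω → Fin k → ℝ} {μ : ℕ → Ω → ∀ i, A i} {X : ℕ → Ω → ℕ → S}
  {θ : ℕ → Ω → Fin k → ℝ} {β : ℕ → ℝ} {c : Fin k}

theorem measurable_visitNoise_comp [∀ i, Finite (A i)]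
    (h_run : M.IsAggregatedOPI cl p θ₀ Pr ℱ γ μ X θ) (t : ℕ) (c : Fin k) :
    Measurable[ℱ (t + 1)] fun ω => M.visitNoise cl c (μ t ω) (X t ω) :=
  measurable_comp_choice (h_run.traj_measurable t)
    (fun π => ℱ.mono t.le_succ _ (h_run.policy_measurable t π)) (M.measurable_visitNoise cl c)

theorem update_sub (h_run : M.IsAggregatedOPI cl p θ₀ Pr ℱ γ μ X θ) {t : ℕ} {ω : Ω} {v : ℝ}
    (hv : ∀ i, cl i = c → M.value (μ t ω) i = v) :
    θ (t + 1) ω c - v =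
      (1 - effectiveStep cl (fun τ => X τ ω) c (fun τ => γ τ ω c) t) * (θ t ω c - v) +
        γ t ω c * M.visitNoise cl c (μ t ω) (X t ω) := by
  by_cases h : Visits cl (X t ω) c
  · have hnoise : M.visitNoise cl c (μ t ω) (X t ω) = M.tailCost cl (μ t ω) (X t ω) c - v := by
      simp [visitNoise, h, hv _ h.cl_firstVisit]
    rw [hnoise, effectiveStep_of_visits h, h_run.update_visited t ω c h]
    ring
  · simp [effectiveStep_of_not_visits, visitNoise, h, h_run.update_not_visited t ω c h]

theorem tendsto_of_eventually_value_eq (h_run : M.IsAggregatedOPI cl p θ₀ Pr ℱ γ μ X θ)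
    (h_step : IsStepSizeRule cl β X γ) (hβ : ∀ t, 0 ≤ β t) (hβ_sq : Summable fun t => β t ^ 2)
    {ω : Ω} (hsteps : Tendsto (fun n => ∑ t ∈ Finset.range n,
      effectiveStep cl (fun τ => X τ ω) c (fun τ => γ τ ω c) t) atTop atTop)
    {l : ℝ} (hnoise : Tendsto (fun n => ∑ t ∈ Finset.range n,
      γ t ω c * M.visitNoise cl c (μ t ω) (X t ω)) atTop (𝓝 l))
    {v : ℝ} (hv : ∀ᶠ t in atTop, ∀ i, cl i = c → M.value (μ t ω) i = v) :
    Tendsto (fun t => θ t ω c) atTop (𝓝 v) := by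
  have hsub : Tendsto (fun t => θ t ω c - v) atTop (𝓝 0) := by
    refine tendsto_zero_of_averaging_add_noise
      (h_step.eventually_effectiveStep_mem_Icc hβ hβ_sq c ω) hsteps hnoise ?_
    filter_upwards [hv] with t ht
    rw [h_run.update_sub ht, Finset.sum_range_succ, add_sub_cancel_left, smul_eq_mul]
  simpa using hsub.add_const v

variable [∀ i, Finite (A i)]

theorem exists_le_condProb_visits [∀ i, Nonempty (A i)]
    (h_run : M.IsAggregatedOPI cl p θ₀ Pr ℱ γ μ X θ)
    (h_reach : ∀ π, 0 < M.chainLaw p π {x | Visits cl x c}) :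
    ∃ δ > 0, ∀ t, ∀ᵐ ω ∂Pr, δ ≤ (Pr⟦X t ⁻¹' {x | Visits cl x c} | ℱ t⟧) ω := by
  obtain ⟨π₀, hπ₀⟩ := Finite.exists_min fun π => (M.chainLaw p π).real {x | Visits cl x c}
  refine ⟨_, ENNReal.toReal_pos (h_reach π₀).ne' (measure_ne_top _ _), fun t => ?_⟩
  filter_upwards [h_run.traj_law t _ (measurableSet_visits cl c)] with ω hω
  exact (hπ₀ (μ t ω)).trans_eq hω.symm

variable [IsFiniteMeasure Pr]

theorem condExp_visitNoise (h_run : M.IsAggregatedOPI cl p θ₀ Pr ℱ γ μ X θ) (t : ℕ)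
    (c : Fin k) : Pr[fun ω => M.visitNoise cl c (μ t ω) (X t ω) | ℱ t] =ᵐ[Pr] 0 := by
  obtain ⟨D, hD⟩ := M.exists_abs_visitNoise_le cl c
  refine (condExp_comp_of_condLaw (ℱ.le t) ((h_run.traj_measurable t).mono (ℱ.le _) le_rfl)
    (h_run.policy_measurable t) (h_run.traj_law t) (M.measurable_visitNoise cl c) hD).trans
    (ae_of_all _ fun ω => M.integral_chainLaw_visitNoise cl c _ p)

theorem ae_exists_tendsto_sum_visitNoise (h_run : M.IsAggregatedOPI cl p θ₀ Pr ℱ γ μ X θ)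
    (h_step : IsStepSizeRule cl β X γ) (hβ_sq : Summable fun t => β t ^ 2) (c : Fin k) :
    ∀ᵐ ω ∂Pr, ∃ l, Tendsto
      (fun n => ∑ t ∈ Finset.range n, γ t ω c * M.visitNoise cl c (μ t ω) (X t ω)) atTop
      (𝓝 l) := by
  obtain ⟨D, hD⟩ := M.exists_abs_visitNoise_le cl c
  have hsq := h_step.sum_mul_visitNoise_sq_le hβ_sq c hD μ
  have hγ := fun t => h_step.measurable h_run.traj_measurable t c
  have hm : ∀ t, Measurable[ℱ (t + 1)] fun ω => γ t ω c * M.visitNoise cl c (μ t ω) (X t ω) :=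
    fun t => ((hγ t).mono (ℱ.mono t.le_succ) le_rfl).mul (h_run.measurable_visitNoise_comp t c)
  have hbdd : ∀ t ω, |γ t ω c * M.visitNoise cl c (μ t ω) (X t ω)| ≤
      √((∑' t, β t ^ 2) * D ^ 2) := fun t ω => Real.abs_le_sqrt <|
    (Finset.single_le_sum (f := fun t => (γ t ω c * M.visitNoise cl c (μ t ω) (X t ω)) ^ 2)
      (fun _ _ => sq_nonneg _) (Finset.self_mem_range_succ t)).trans (hsq (t + 1) ω)
  refine ae_exists_tendsto_sum_range_of_sum_sq_le (fun t => (hm t).stronglyMeasurable)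
    (fun t => ?_) hsq
  refine condExp_mul_eq_zero (hγ t).stronglyMeasurable ?_ ?_ (h_run.condExp_visitNoise t c)
  · exact .of_bound ((h_run.measurable_visitNoise_comp t c).mono
      (ℱ.le _) le_rfl).aestronglyMeasurable D (ae_of_all _ fun ω => hD _ _)
  · exact .of_bound ((hm t).mono (ℱ.le _) le_rfl).aestronglyMeasurable _ (ae_of_all _ (hbdd t))

variable [∀ i, Nonempty (A i)]

theorem ae_tendsto_sum_effectiveStep_of_bdd (h_run : M.IsAggregatedOPI cl p θ₀ Pr ℱ γ μ X θ)
    (h_reach : ∀ π, 0 < M.chainLaw p π {x | Visits cl x c}) {w : ℕ → ℝ} (hw0 : ∀ t, 0 ≤ w t)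
    {R : NNReal} (hwR : ∀ t, w t ≤ R)
    (hw : Tendsto (fun n => ∑ t ∈ Finset.range n, w t) atTop atTop) :
    ∀ᵐ ω ∂Pr, Tendsto
      (fun n => ∑ t ∈ Finset.range n, effectiveStep cl (fun τ => X τ ω) c w t) atTop atTop := by
  obtain ⟨δ, hδ, hδE⟩ := h_run.exists_le_condProb_visits h_reach
  exact ae_tendsto_sum_indicator_of_le_condProb
    (fun t => h_run.traj_measurable t (measurableSet_visits cl c)) hδ hδE hw0 hwR hw

theorem ae_tendsto_visitCount (h_run : M.IsAggregatedOPI cl p θ₀ Pr ℱ γ μ X θ)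
    (h_reach : ∀ π, 0 < M.chainLaw p π {x | Visits cl x c}) :
    ∀ᵐ ω ∂Pr, Tendsto (fun n => visitCount cl (fun τ => X τ ω) n c) atTop atTop := by
  filter_upwards [h_run.ae_tendsto_sum_effectiveStep_of_bdd h_reach (w := fun _ => 1) (R := 1)
    (fun _ => zero_le_one) (fun _ => le_rfl)
    (by simpa using tendsto_natCast_atTop_atTop)] with ω hω
  simpa [sum_effectiveStep_comp_visitCount _ c fun _ => (1 : ℝ),
    tendsto_natCast_atTop_iff] using hω

theorem ae_tendsto_sum_effectiveStep (h_run : M.IsAggregatedOPI cl p θ₀ Pr ℱ γ μ X θ)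
    (h_step : IsStepSizeRule cl β X γ)
    (h_reach : ∀ π, 0 < M.chainLaw p π {x | Visits cl x c}) (hβ : ∀ t, 0 ≤ β t)
    (hβ_sum : Tendsto (fun n => ∑ t ∈ Finset.range n, β t) atTop atTop)
    (hβ_sq : Summable fun t => β t ^ 2) :
    ∀ᵐ ω ∂Pr, Tendsto (fun n => ∑ t ∈ Finset.range n,
      effectiveStep cl (fun τ => X τ ω) c (fun τ => γ τ ω c) t) atTop atTop := by
  rcases h_step with h | h
  · simp only [h]
    refine h_run.ae_tendsto_sum_effectiveStep_of_bdd h_reach hβ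
      (R := (√(∑' t, β t ^ 2)).toNNReal) (fun t => ?_) hβ_sum
    rw [Real.coe_toNNReal _ (Real.sqrt_nonneg _)]
    exact Real.le_sqrt_of_sq_le (hβ_sq.le_tsum t fun _ _ => sq_nonneg _)
  · filter_upwards [h_run.ae_tendsto_visitCount h_reach] with ω hω
    simp only [h, sum_effectiveStep_comp_visitCount _ c β]
    exact hβ_sum.comp hω

end IsAggregatedOPI

end DiscountedMDP

theorem mainTheorem4_general
    {S : Type*} [Fintype S] [MeasurableSpace S] [MeasurableSingletonClass S]
    {A : S → Type*} [∀ i, Finite (A i)] [∀ i, Nonempty (A i)] (M : DiscountedMDP S A)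
    {level : S → ℕ} (h_level : M.IsLevelFunction level) {k : ℕ} (cl : S → Fin k)
    (h_value : ∀ i j, cl i = cl j → M.optValue i = M.optValue j)
    (h_cluster : ∀ i j, cl i = cl j → level i = level j)
    (p : PMF S)
    (h_reach : ∀ (π : ∀ i, A i) (c : Fin k),
      0 < M.chainLaw p π {x | DiscountedMDP.Visits cl x c})
    (β : ℕ → ℝ) (hβ_nonneg : ∀ t, 0 ≤ β t)
    (hβ_sum : Tendsto (fun n => ∑ t ∈ Finset.range n, β t) atTop atTop)
    (hβ_sq : Summable fun t => β t ^ 2)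
    {Ω : Type*} {mΩ : MeasurableSpace Ω} (Pr : Measure Ω) [IsFiniteMeasure Pr]
    (ℱ : Filtration ℕ mΩ)
    (θ₀ : Fin k → ℝ) (γ : ℕ → Ω → Fin k → ℝ)
    (μ : ℕ → Ω → ∀ i, A i) (X : ℕ → Ω → ℕ → S) (θ : ℕ → Ω → Fin k → ℝ)
    (h_run : M.IsAggregatedOPI cl p θ₀ Pr ℱ γ μ X θ)
    (h_step : DiscountedMDP.IsStepSizeRule cl β X γ) :
    ∀ᵐ ω ∂Pr, ∀ i, Tendsto (fun t => θ t ω (cl i)) atTop (𝓝 (M.optValue i)) := by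
  have hsteps := ae_all_iff.2 fun c => h_run.ae_tendsto_sum_effectiveStep h_step
    (fun π => h_reach π c) hβ_nonneg hβ_sum hβ_sq
  have hnoise := ae_all_iff.2 fun c => h_run.ae_exists_tendsto_sum_visitNoise h_step hβ_sq c
  filter_upwards [hsteps, hnoise] with ω hω_steps hω_noise i
  induction hd : level i using Nat.strong_induction_on generalizing i with
  | _ d ih =>
    have hopt := h_level.eventually_value_eq_optValue (fun t π => h_run.greedy t ω π)
      fun j hj => ih _ hj j rfl
    obtain ⟨l, hl⟩ := hω_noise (cl i)
    refine h_run.tendsto_of_eventually_value_eq h_step hβ_nonneg hβ_sq (hω_steps _) hl ?_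
    filter_upwards [hopt] with t ht j hji
    rw [ht j ((h_cluster j i hji).trans hd).le, h_value j i hji]

theorem mainTheorem4
    {S : Type*} [Fintype S] [MeasurableSpace S] [MeasurableSingletonClass S]
    {A : S → Type*} [∀ i, Finite (A i)] [∀ i, Nonempty (A i)]
    (M : DiscountedMDP S A)
    (h_common : M.CommonTransitions)
    (h_acyclic : M.TransientAcyclic)
    (h_absorbing : ∀ i, ¬ M.IsTransient i → M.IsAbsorbing i)
    {k : ℕ} (cl : S → Fin k)
    (h_value : ∀ i j, cl i = cl j → M.optValue i = M.optValue j)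
    (h_dist : ∀ i j, cl i = cl j → M.maxDist i = M.maxDist j)
    (p : PMF S)
    (h_reach : ∀ (π : ∀ i, A i) (c : Fin k),
      0 < M.chainLaw p π {x | DiscountedMDP.Visits cl x c})
    (β : ℕ → ℝ) (hβ_nonneg : ∀ t, 0 ≤ β t)
    (hβ_sum : Tendsto (fun n => ∑ t ∈ Finset.range n, β t) atTop atTop)
    (hβ_sq : Summable fun t => β t ^ 2)
    {Ω : Type*} {mΩ : MeasurableSpace Ω} (Pr : Measure Ω) [IsProbabilityMeasure Pr]
    (ℱ : Filtration ℕ mΩ)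
    (θ₀ : Fin k → ℝ) (γ : ℕ → Ω → Fin k → ℝ)
    (μ : ℕ → Ω → ∀ i, A i) (X : ℕ → Ω → ℕ → S) (θ : ℕ → Ω → Fin k → ℝ)
    (h_run : M.IsAggregatedOPI cl p θ₀ Pr ℱ γ μ X θ)
    (h_step : (∀ t ω c, γ t ω c = β t) ∨
      (∀ t ω c, γ t ω c = β (DiscountedMDP.visitCount cl (fun τ => X τ ω) t c))) :
    ∀ᵐ ω ∂Pr, ∀ i, Tendsto (fun t => θ t ω (cl i)) atTop (𝓝 (M.optValue i)) := by
  exact mainTheorem4_general M (DiscountedMDP.isLevelFunction_maxDist h_acyclic h_absorbing) cl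
    h_value h_dist p h_reach β hβ_nonneg hβ_sum hβ_sq Pr ℱ θ₀ γ μ X θ h_run h_step
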